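/- Let $p$ be a prime and let $F$ be a field of characteristic $p$. Let $\mathcal{D}=F(x)[\tau]$ be the ring of linear difference operators, with multiplication determined by $\tau\cdot r(x)=r(x+1)\cdot\tau$ for $r\in F(x)$, and let $\mathcal{P}=F[x][\tau]\subset\mathcal{D}$. For a nonzero $M=\sum_{i=0}^n a_i(x)\tau^i\in\mathcal{P}$ with $a_n\neq 0$ put $\mathrm{ord}(M)=n$ and let $\mathfrak{lc}(M)\in F[x]$ be the polynomial $a_n(x-n)$ divided by its leading coefficient (so it is monic). For a nonzero $L\in\mathcal{D}$ let $\mathfrak{lc}_\infty(L)\in F[x]$ be the monic generator of the ideal of $F[x]$ generated by all $\mathfrak{lc}(AL)$ with $A\in\mathcal{D}$, $A\ne 0$ and $AL\in\mathcal{P}$. Two nonzero rational functions $r_1,r_2\in F(x)$ are called shift equivalent if $\frac{r_1(x)}{r_2(x)}=\frac{f(x+1)}{f(x)}$ for some nonzero $f\in F(x)$. Let $L_1,L_2\in\mathcal{D}$ be nonzero, and suppose that either 1. $L=L_1L_2$, or 2. $L=\mathrm{LCLM}(L_1,L_2)$ is a least common left multiple of $L_1$ and $L_2$ (determined up to a left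 factor in $F(x)\setminus\{0\}$), and the greatest common right divisor $\mathrm{GCRD}(L_1,L_2)$ is $1$. Then $\mathfrak{lc}_\infty(L)$ and $\mathfrak{lc}_\infty(L_1)\,\mathfrak{lc}_\infty(L_2)$ are shift equivalent. -/

import Mathlib

noncomputable section

namespace ShiftOperator

open Polynomial

variable (F : Type*) [Field F]

/-- The automorphism `r(x) ↦ r(x + 1)` of the rational function field `F(x)`. -/
def shiftAut : RingAut (RatFunc F) :=
  IsFractionRing.ringEquivOfRingEquiv (A := F[X]) (B := F[X])
    (algEquivAevalXAddC (1 : F)).toRingEquiv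

/-- The action of `n` on `F(x)` is `r(x) ↦ r(x + n)`; it turns `SkewPolynomial (RatFunc F)` into
the ring with the commutation rule `τ · r(x) = r(x + 1) · τ`. -/
instance shiftAction : MulSemiringAction (Multiplicative ℕ) (RatFunc F) :=
  MulSemiringAction.compHom (RatFunc F) (powersHom (RingAut (RatFunc F)) (shiftAut F))

/-- The ring `F(x)[τ]` of linear difference operators. -/
abbrev Operators : Type _ := SkewPolynomial (RatFunc F)

theorem shiftAut_algebraMap (f : F[X]) :
    shiftAut F (algebraMap F[X] (RatFunc F) f)
      = algebraMap F[X] (RatFunc F) (f.comp (X + C 1)) := by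
  simp [shiftAut, algEquivAevalXAddC, aeval_def, eval₂_eq_eval_map, comp]

/-- The defining commutation rule `τ · r(x) = r(x + 1) · τ`. -/
theorem tau_mul (r : RatFunc F) :
    (SkewPolynomial.X : Operators F) * SkewPolynomial.C r
      = SkewPolynomial.C (shiftAut F r) * SkewPolynomial.X := by
  rw [← SkewPolynomial.monomial_zero_left, SkewPolynomial.X_mul_monomial,
    ← SkewPolynomial.monomial_zero_left, SkewPolynomial.monomial_mul_X]
  rfl

variable {F}

/-- `L` lies in the subring `F[x][τ]`. -/
def IsPolynomialOp (L : Operators F) : Prop :=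
  ∀ i, ∃ a : F[X], L.coeff i = algebraMap F[X] (RatFunc F) a

/-- The order of an operator: the largest exponent of `τ` (and `0` for the zero operator). -/
def ord (L : Operators F) : ℕ := L.support.sup id

/-- The scalar multiple of `f` with leading coefficient `1` (and `0` for `f = 0`). -/
def makeMonic (f : F[X]) : F[X] := C f.leadingCoeff⁻¹ * f

/-- For `L = ∑ aᵢ(x) τⁱ` in `F[x][τ]` of order `n`, the polynomial `aₙ(x - n)` made monic.
On `F[x][τ]` the coefficient `aₙ` is a polynomial, and so is equal to its numerator. -/
def lc (L : Operators F) : F[X] :=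
  makeMonic ((L.coeff (ord L)).num.comp (X - C (ord L : F)))

/-- `{0} ∪ {lc(AL) : A ∈ F(x)[τ], AL ∈ F[x][τ], ord A = k}`. -/
def lcSet (L : Operators F) (k : ℕ) : Set F[X] :=
  {0} ∪ {f | ∃ A : Operators F, IsPolynomialOp (A * L) ∧ ord A = k ∧ f = lc (A * L)}

/-- The ideal of `F[x]` generated by all `lc(AL)` with `A ∈ F(x)[τ]` and `AL ∈ F[x][τ]`
(up to constant factors, this ideal is the union of the sets `lcSet L k` itself). -/
def lcIdeal (L : Operators F) : Ideal F[X] := Ideal.span (⋃ k, lcSet L k)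

/-- The essential part of the leading coefficient of `L`: the monic generator of `lcIdeal L`. -/
def lcInf (L : Operators F) : F[X] :=
  makeMonic (Submodule.IsPrincipal.generator (lcIdeal L))

/-- `r₁` and `r₂` are nonzero and `r₁ / r₂ = f(x + 1) / f(x)` for some nonzero `f ∈ F(x)`. -/
def ShiftEquivalent (r₁ r₂ : RatFunc F) : Prop :=
  r₁ ≠ 0 ∧ r₂ ≠ 0 ∧ ∃ f : RatFunc F, f ≠ 0 ∧ r₁ / r₂ = shiftAut F f / f

/-- `R` is a right divisor of `L`, i.e. `L` is a left multiple of `R`. -/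
def RightDvd (R L : Operators F) : Prop := ∃ A : Operators F, L = A * R

/-- `G` is a greatest common right divisor of `L₁` and `L₂`. -/
def IsGCRD (G L₁ L₂ : Operators F) : Prop :=
  RightDvd G L₁ ∧ RightDvd G L₂ ∧ ∀ R, RightDvd R L₁ → RightDvd R L₂ → RightDvd R G

/-- `L` is a least common left multiple of `L₁` and `L₂` (it is unique up to a left factor in
`F(x) - {0}`). -/
def IsLCLM (L L₁ L₂ : Operators F) : Prop :=
  RightDvd L₁ L ∧ RightDvd L₂ L ∧ ∀ M, RightDvd L₁ M → RightDvd L₂ M → RightDvd L M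

end ShiftOperator

end

noncomputable section

namespace ShiftOperator

open Polynomial Matrix

/-! ### Polynomial matrices with nonsingular top coefficient -/

section PolynomialMatrix

variable {R : Type*} [CommRing R] {n : Type*} [Fintype n] [DecidableEq n]

/-! In characteristic `p` the shift has order `p`, so `T = τ^p` commutes with `F(x)`, and `F(x)[τ]`
is a free left module of rank `p` over the commutative ring `F(x)[T]`. Right multiplication by `L`
is linear over that ring; its determinant, the reduced norm of `L`, is multiplicative in `L`.

The bridge is `hasPrimitiveLead_det_mulRightMatrix`: made primitive over `F[x]`, the norm has
leading coefficient `∏_{j<p} (lcInf L)(x + j)` up to a unit. For suitable `m`, integral left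
multiples of `L` at orders `p * m + j`, all realising `lcInf L`, give a matrix `E` whose
`T^m`-coefficient is triangular with this product as determinant. Now `det E` is primitive
(`isPrimitive_det`), is a multiple of the norm, and differs from the norm's primitive part only by a
divisor of a monic polynomial (`exists_monic_smul_mem_rows`, `hasPrimitiveLead_of_mul`).

By Gauss's lemma these leading coefficients multiply, so `lcInf L` and `lcInf L₁ * lcInf L₂` have
the same product of shifts, and Hilbert 90 (`exists_shiftAut_div_eq`) makes them shift equivalent.
If `A * L₂` is the LCLM, coprimality forces the norms of `A` and `L₁` to agree up to a nonzero
constant in `F(x)` (`exists_det_mulRightMatrix_eq`), which reduces this case to that of a product.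
-/

theorem natDegree_det_le (E : Matrix n n R[X]) (m : ℕ) (hE : ∀ i j, (E i j).natDegree ≤ m) :
    E.det.natDegree ≤ Fintype.card n * m := by
  rw [det_apply]
  refine natDegree_sum_le_of_forall_le _ _ fun σ _ => ?_
  refine (natDegree_smul_le _ _).trans ((natDegree_prod_le _ _).trans ?_)
  refine (Finset.sum_le_card_nsmul _ _ m fun i _ => hE _ _).trans ?_
  simp

theorem coeff_det_of_natDegree_le (E : Matrix n n R[X]) (m : ℕ)
    (hE : ∀ i j, (E i j).natDegree ≤ m) :
    E.det.coeff (Fintype.card n * m) = (E.map fun f => f.coeff m).det := by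
  rw [det_apply, det_apply, finsetSum_coeff]
  refine Finset.sum_congr rfl fun σ _ => ?_
  rw [coeff_smul]
  congr 1
  have := coeff_prod_of_natDegree_le (s := (Finset.univ : Finset n)) (fun i => E (σ i) i) m
    (fun i _ => hE _ _)
  simpa using this

theorem leadingCoeff_det (E : Matrix n n R[X]) (m : ℕ) (hE : ∀ i j, (E i j).natDegree ≤ m)
    (hdet : (E.map fun f => f.coeff m).det ≠ 0) :
    E.det.leadingCoeff = (E.map fun f => f.coeff m).det := by
  rw [← coeff_det_of_natDegree_le E m hE] at hdet ⊢
  rw [leadingCoeff, le_antisymm (natDegree_det_le E m hE) (le_natDegree_of_ne_zero hdet)]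

/-- No cancellation of top terms is possible: if `a` is the largest degree in `b`, the vector of
`a`-th coefficients would be killed by the nonsingular top coefficient matrix of `E`. -/
theorem eq_zero_of_degree_vecMul_lt [IsDomain R] (E : Matrix n n R[X]) (m : ℕ)
    (hE : ∀ i j, (E i j).natDegree ≤ m) (hdet : (E.map fun f => f.coeff m).det ≠ 0)
    (b : n → R[X]) (hb : ∀ j, ((b ᵥ* E) j).degree < m) : b = 0 := by
  classical
  by_contra hne
  obtain ⟨i₀, hi₀⟩ := Function.ne_iff.mp hne
  obtain ⟨i, hib, hi⟩ := Finset.exists_max_image (Finset.univ.filter fun i => b i ≠ 0)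
    (fun i => (b i).natDegree) ⟨i₀, by simpa using hi₀⟩
  have hib : b i ≠ 0 := by simpa using hib
  set a := (b i).natDegree with ha
  have hle : ∀ j, (b j).natDegree ≤ a := fun j => by
    by_cases h : b j = 0
    · simp [h]
    · exact hi j (by simpa using h)
  have hv : (fun j => (b j).coeff a) ᵥ* (E.map fun f => f.coeff m) = 0 := by
    ext j
    have h0 : ((b ᵥ* E) j).coeff (a + m) = 0 :=
      coeff_eq_zero_of_degree_lt ((hb j).trans_le (by exact_mod_cast Nat.le_add_left m a))
    refine Eq.trans ?_ h0
    simp only [vecMul, dotProduct, finsetSum_coeff, Matrix.map_apply]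
    exact Finset.sum_congr rfl fun l _ =>
      (coeff_mul_add_eq_of_natDegree_le (hle l) (hE l j)).symm
  have := eq_zero_of_vecMul_eq_zero hdet hv
  exact hib (leadingCoeff_eq_zero.mp (congrFun this i))

/-- A criterion for the determinant of a matrix over `R[X]` to be a primitive polynomial: its rows
generate, up to vectors of low degree, a saturated submodule. -/
theorem isPrimitive_det [IsDomain R] [IsPrincipalIdealRing R] (E : Matrix n n R[X]) (m : ℕ)
    (hE : ∀ i j, (E i j).natDegree ≤ m) (hdet : (E.map fun f => f.coeff m).det ≠ 0)
    (M : Submodule R[X] (n → R[X])) (hEM : ∀ i, E i ∈ M)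
    (hsat : ∀ (r : R) (w : n → R[X]), r ≠ 0 → C r • w ∈ M → w ∈ M)
    (hred : ∀ w ∈ M, ∃ b : n → R[X], ∀ j, ((w - b ᵥ* E) j).degree < m) :
    E.det.IsPrimitive := by
  have hdet0 : E.det ≠ 0 := by
    intro h
    rw [← coeff_det_of_natDegree_le E m hE, h] at hdet
    simp at hdet
  intro r hr
  by_contra hru
  have hr0 : r ≠ 0 := by
    rintro rfl
    rw [C_0, zero_dvd_iff] at hr
    exact hdet0 hr
  obtain ⟨q, hq, hqr⟩ := WfDvdMonoid.exists_irreducible_factor hru hr0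
  have hqdet : C q ∣ E.det := (_root_.map_dvd C hqr).trans hr
  have hprime : (Ideal.span {q}).IsPrime :=
    (Ideal.span_singleton_prime hq.ne_zero).mpr hq.prime
  let π : R →+* R ⧸ Ideal.span {q} := Ideal.Quotient.mk _
  have hπ : ∀ f : R[X], f.map π = 0 → C q ∣ f := fun f hf => by
    rw [C_dvd_iff_dvd_coeff]
    intro i
    have := congrArg (fun g => coeff g i) hf
    simp only [coeff_map, coeff_zero] at this
    exact Ideal.mem_span_singleton.mp (Ideal.Quotient.eq_zero_iff_mem.mp this)
  have hdetq : ((mapRingHom π).mapMatrix E).det = 0 := by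
    rw [← RingHom.map_det]
    obtain ⟨g, hg⟩ := hqdet
    have hq0 : π q = 0 := Ideal.Quotient.eq_zero_iff_mem.mpr (Ideal.mem_span_singleton_self q)
    simp [hg, hq0]
  -- A prime `q` dividing `det E` yields a nontrivial row relation modulo `q`. Its lift `c`
  -- satisfies `c E = q w`, and saturation puts `w` in `M`.
  obtain ⟨v, hv0, hv⟩ := exists_vecMul_eq_zero_iff.mpr hdetq
  choose c hc using fun i => map_surjective π Ideal.Quotient.mk_surjective (v i)
  have hdvd : ∀ j, C q ∣ (c ᵥ* E) j := fun j => by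
    apply hπ
    have := congrFun hv j
    simp only [vecMul, dotProduct, RingHom.mapMatrix_apply, Matrix.map_apply,
      coe_mapRingHom, Pi.zero_apply] at this
    simpa [vecMul, dotProduct, Polynomial.map_sum, hc] using this
  choose w hw using hdvd
  have hcE : c ᵥ* E = C q • w := funext fun j => by simpa using hw j
  have hwM : w ∈ M := by
    refine hsat q w hq.ne_zero ?_
    rw [← hcE]
    have : c ᵥ* E = ∑ i, c i • E i := by
      ext j; simp [vecMul, dotProduct]
    rw [this]
    exact M.sum_mem fun i _ => M.smul_mem _ (hEM i)
  obtain ⟨b, hb⟩ := hred w hwM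
  -- Reducing `w` by `E` makes `(c - q b) E = q (w - b E)` of degree below `m`, so `c = q b`,
  -- contradicting the nontriviality of `v` modulo `q`.
  have hz : c - C q • b = 0 := by
    refine eq_zero_of_degree_vecMul_lt E m hE hdet _ fun j => ?_
    have : (c - C q • b) ᵥ* E = C q • (w - b ᵥ* E) := by
      rw [sub_vecMul, hcE, smul_vecMul, smul_sub]
    rw [this, Pi.smul_apply, smul_eq_mul]
    exact (degree_C_mul hq.ne_zero).trans_lt (hb j)
  apply hv0
  ext1 i
  have hci := congrFun hz i
  have hq0 : π q = 0 := Ideal.Quotient.eq_zero_iff_mem.mpr (Ideal.mem_span_singleton_self q)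
  rw [← hc i, sub_eq_zero.mp hci]
  simp [hq0]

omit [DecidableEq n] in
/-- If vectors in `M` can be reduced modulo the rows of `E` to vectors of bounded degree, then some
monic polynomial multiplies `M` into the row space of `E`. -/
theorem exists_monic_smul_mem_rows [IsNoetherianRing R] [Nontrivial R] (E : Matrix n n R[X]) (m : ℕ)
    (M : Submodule R[X] (n → R[X])) (hEM : ∀ i, E i ∈ M)
    (hred : ∀ w ∈ M, ∃ b : n → R[X], ∀ j, ((w - b ᵥ* E) j).degree < m) :
    ∃ h : R[X], h.Monic ∧ ∀ w ∈ M, ∃ b : n → R[X], h • w = b ᵥ* E := by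
  let N : Submodule R[X] (n → R[X]) := LinearMap.range E.vecMulLinear
  let H : Submodule R[X] ((n → R[X]) ⧸ N) := M.map N.mkQ
  -- Vectors of degree below `m` form a finite module over the Noetherian ring `R`, so the quotient
  -- of `M` by the row space is finite over `R`.
  let Φ : (n → Fin m → R) →ₗ[R] (n → R[X]) :=
    LinearMap.pi fun i => (∑ j : Fin m, monomial (j : ℕ) ∘ₗ LinearMap.proj j) ∘ₗ LinearMap.proj i
  have hΦ : ∀ w : n → R[X], (∀ j, (w j).degree < m) → Φ (fun i j => (w i).coeff j) = w := by
    intro w hw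
    ext1 i
    ext k
    simp only [Φ, LinearMap.pi_apply, LinearMap.comp_apply, LinearMap.sum_apply,
      LinearMap.proj_apply, finsetSum_coeff, coeff_monomial]
    rw [Fin.sum_univ_eq_sum_range fun j => if j = k then (w i).coeff j else 0]
    simp only [Finset.sum_ite_eq', Finset.mem_range]
    split_ifs with hk
    · rfl
    · exact (coeff_eq_zero_of_degree_lt
        ((hw i).trans_le (by exact_mod_cast not_lt.mp hk))).symm
  have hN : N ≤ M := by
    rintro _ ⟨b, rfl⟩
    have : b ᵥ* E = ∑ i, b i • E i := by
      ext j; simp [vecMul, dotProduct]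
    simp only [vecMulLinear_apply]
    rw [this]
    exact M.sum_mem fun i _ => M.smul_mem _ (hEM i)
  let S : Submodule R (n → Fin m → R) := (M.restrictScalars R).comap Φ
  have hHS : H.restrictScalars R = S.map ((N.mkQ.restrictScalars R) ∘ₗ Φ) := by
    ext x
    constructor
    · rintro ⟨w, hw, rfl⟩
      obtain ⟨b, hb⟩ := hred w hw
      refine ⟨fun i j => ((w - b ᵥ* E) i).coeff j, ?_, ?_⟩
      · change Φ _ ∈ M
        rw [hΦ _ hb]
        exact M.sub_mem hw (hN ⟨b, rfl⟩)
      · simp only [LinearMap.comp_apply, hΦ _ hb, LinearMap.restrictScalars_apply, map_sub]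
        rw [sub_eq_self]
        exact (Submodule.Quotient.mk_eq_zero N).mpr ⟨b, rfl⟩
    · rintro ⟨x, hx, rfl⟩
      exact ⟨Φ x, hx, rfl⟩
  have hfin : Module.Finite R H := by
    have : (H.restrictScalars R).FG := by
      rw [hHS]
      exact (IsNoetherian.noetherian S).map _
    exact Module.Finite.iff_fg.mpr this
  -- Cayley–Hamilton for multiplication by `X` on this finite `R`-module.
  obtain ⟨h, hmon, hh⟩ :=
    LinearMap.exists_monic_and_aeval_eq_zero R (Algebra.lsmul R R H (X : R[X]))
  refine ⟨h, hmon, fun w hw => ?_⟩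
  rw [aeval_algHom_apply, aeval_X_left_apply] at hh
  have h1 := LinearMap.congr_fun hh ⟨N.mkQ w, w, hw, rfl⟩
  have h2 : h • N.mkQ w = 0 := congrArg Subtype.val h1
  rw [← map_smul] at h2
  obtain ⟨b, hb⟩ := (Submodule.Quotient.mk_eq_zero N).mp h2
  exact ⟨b, hb.symm⟩

end PolynomialMatrix

/-! ### Gauss's lemma and leading coefficients of primitive parts -/

section Gauss

variable {R : Type*} [CommRing R] [IsDomain R] {K : Type*} [Field K] [Algebra R K]
  [IsFractionRing R K]

theorem exists_C_mul_eq_map (f : K[X]) :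
    ∃ (c : R) (g : R[X]), c ≠ 0 ∧ C (algebraMap R K c) * f = g.map (algebraMap R K) := by
  obtain ⟨c, hc, h⟩ := IsLocalization.integerNormalization_spec (nonZeroDivisors R) f
  refine ⟨c, _, nonZeroDivisors.ne_zero hc, Eq.trans ?_ h.symm⟩
  rw [Algebra.smul_def, Polynomial.algebraMap_apply]

theorem exists_C_mul_matrix_eq_map {n : Type*} [Fintype n] [DecidableEq n] (A : Matrix n n K[X]) :
    ∃ (c : R) (B : Matrix n n R[X]), c ≠ 0 ∧
      C (algebraMap R K c) • A = (mapRingHom (algebraMap R K)).mapMatrix B := by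
  choose c g hc hg using fun x : n × n => exists_C_mul_eq_map (R := R) (A x.1 x.2)
  refine ⟨∏ x, c x, Matrix.of fun i j => C (∏ x ∈ Finset.univ.erase (i, j), c x) * g (i, j),
    Finset.prod_ne_zero_iff.mpr fun x _ => hc x, ?_⟩
  ext1 i j
  rw [← Finset.prod_erase_mul _ _ (Finset.mem_univ (i, j))]
  simp only [Matrix.smul_apply, smul_eq_mul, RingHom.mapMatrix_apply, Matrix.map_apply, of_apply,
    coe_mapRingHom, Polynomial.map_mul, map_C, ← hg (i, j), map_mul, mul_assoc]

/-- Some nonzero constant multiple of `f` is a primitive polynomial over `R` whose leading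
coefficient is associated to `r`. -/
def HasPrimitiveLead (f : K[X]) (r : R) : Prop :=
  ∃ (ν : R[X]) (c : K), ν.IsPrimitive ∧ c ≠ 0 ∧ C c * f = ν.map (algebraMap R K) ∧
    Associated ν.leadingCoeff r

omit [IsFractionRing R K] in
theorem HasPrimitiveLead.ne_zero [FaithfulSMul R K] {f : K[X]} {r : R}
    (hf : HasPrimitiveLead f r) : f ≠ 0 := by
  obtain ⟨ν, c, hν, hc, h1, h2⟩ := hf
  rintro rfl
  rw [mul_zero, eq_comm, Polynomial.map_eq_zero_iff (FaithfulSMul.algebraMap_injective R K)] at h1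
  exact hν.ne_zero h1

variable [IsPrincipalIdealRing R]

theorem _root_.Polynomial.IsPrimitive.mul' {f g : R[X]} (hf : f.IsPrimitive)
    (hg : g.IsPrimitive) : (f * g).IsPrimitive := by
  let _ : NormalizedGCDMonoid R := Nonempty.some inferInstance
  exact hf.mul hg

theorem exists_primitive_C_mul (f : K[X]) (hf : f ≠ 0) :
    ∃ (ν : R[X]) (c : K), ν.IsPrimitive ∧ c ≠ 0 ∧ C c * f = ν.map (algebraMap R K) := by
  let _ : NormalizedGCDMonoid R := Nonempty.some inferInstance
  obtain ⟨c, g, hc, hg⟩ := exists_C_mul_eq_map (R := R) f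
  have hg0 : g ≠ 0 := by
    rintro rfl
    simp [hc, hf] at hg
  have hcont : algebraMap R K g.content ≠ 0 := by
    simpa using mt content_eq_zero_iff.mp hg0
  have hc' : algebraMap R K c ≠ 0 := by simpa using hc
  refine ⟨g.primPart, (algebraMap R K g.content)⁻¹ * algebraMap R K c, g.isPrimitive_primPart,
    mul_ne_zero (inv_ne_zero hcont) hc', ?_⟩
  rw [C_mul, mul_assoc, hg]
  have := congrArg (Polynomial.map (algebraMap R K)) g.eq_C_content_mul_primPart
  rw [this, Polynomial.map_mul, map_C, ← mul_assoc, ← C_mul, inv_mul_cancel₀ hcont, C_1, one_mul]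

omit [IsFractionRing R K] in
theorem HasPrimitiveLead.mul {f g : K[X]} {r s : R} (hf : HasPrimitiveLead f r)
    (hg : HasPrimitiveLead g s) : HasPrimitiveLead (f * g) (r * s) := by
  obtain ⟨ν, c, hν, hc, h1, h2⟩ := hf
  obtain ⟨ν', c', hν', hc', h1', h2'⟩ := hg
  refine ⟨ν * ν', c * c', hν.mul' hν', mul_ne_zero hc hc', ?_, ?_⟩
  · rw [Polynomial.map_mul, ← h1, ← h1', C_mul]; ring
  · rw [leadingCoeff_mul]; exact h2.mul_mul h2'

omit [IsDomain R] [IsFractionRing R K] [IsPrincipalIdealRing R] in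
theorem HasPrimitiveLead.C_mul {f : K[X]} {r : R} (hf : HasPrimitiveLead f r) {c : K}
    (hc : c ≠ 0) : HasPrimitiveLead (C c * f) r := by
  obtain ⟨ν, c', hν, hc', h1, h2⟩ := hf
  refine ⟨ν, c' * c⁻¹, hν, mul_ne_zero hc' (inv_ne_zero hc), ?_, h2⟩
  rw [← mul_assoc, ← Polynomial.C_mul, mul_assoc, inv_mul_cancel₀ hc, mul_one, h1]

theorem leadingCoeff_dvd_of_map_dvd {ν ν' : R[X]} (hν : ν.IsPrimitive)
    (h : ν.map (algebraMap R K) ∣ ν'.map (algebraMap R K)) :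
    ν.leadingCoeff ∣ ν'.leadingCoeff :=
  leadingCoeff_dvd_leadingCoeff (hν.dvd_of_fraction_map_dvd_fraction_map h)

theorem HasPrimitiveLead.associated {f : K[X]} {r s : R} (hf : HasPrimitiveLead f r)
    (hg : HasPrimitiveLead f s) : Associated r s := by
  obtain ⟨ν, c, hν, hc, h1, h2⟩ := hf
  obtain ⟨ν', c', hν', hc', h1', h2'⟩ := hg
  refine h2.symm.trans (Associated.trans ?_ h2')
  have key : ∀ a b : K, a ≠ 0 → C a * f ∣ C b * f := fun a b ha =>
    ⟨C (a⁻¹ * b), by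
      rw [mul_right_comm, ← Polynomial.C_mul, mul_inv_cancel_left₀ ha]⟩
  exact associated_of_dvd_dvd (leadingCoeff_dvd_of_map_dvd (K := K) hν (h1 ▸ h1' ▸ key _ _ hc))
    (leadingCoeff_dvd_of_map_dvd (K := K) hν' (h1 ▸ h1' ▸ key _ _ hc'))

/-- By Gauss, the primitive part `ν` of `f` divides `δ` over `R`, say `δ = ν α`. Cancelling `f` in
`hβ` shows that `α` divides the monic `h`, so `α` has unit leading coefficient and does not affect
that of `δ`. -/
theorem hasPrimitiveLead_of_mul {f u : K[X]} {δ β h : R[X]} {c : K} (hδ : δ.IsPrimitive)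
    (hu : δ.map (algebraMap R K) = u * f) (hh : h.Monic) (hc : c ≠ 0)
    (hβ : C c * h.map (algebraMap R K) * f = β.map (algebraMap R K) * δ.map (algebraMap R K)) :
    HasPrimitiveLead f δ.leadingCoeff := by
  have hinj := IsFractionRing.injective R K
  have hf : f ≠ 0 := by
    rintro rfl
    rw [mul_zero, Polynomial.map_eq_zero_iff hinj] at hu
    exact hδ.ne_zero hu
  obtain ⟨ν, κ, hν, hκ, hνf⟩ := exists_primitive_C_mul (R := R) f hf
  refine ⟨ν, κ, hν, hκ, hνf, ?_⟩
  obtain ⟨α, rfl⟩ : ν ∣ δ := by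
    refine hν.dvd_of_fraction_map_dvd_fraction_map (K := K) ?_
    rw [hu, ← hνf]
    have hκκ : (C κ⁻¹ : K[X]) * C κ = 1 := by rw [← Polynomial.C_mul, inv_mul_cancel₀ hκ, C_1]
    exact ⟨C κ⁻¹ * u, by linear_combination -u * f * hκκ⟩
  have hα : α.IsPrimitive := isPrimitive_of_dvd hδ (dvd_mul_left _ _)
  have hαh : α ∣ h := by
    refine hα.dvd_of_fraction_map_dvd_fraction_map (K := K)
      ⟨C (κ * c⁻¹) * β.map (algebraMap R K), ?_⟩
    rw [Polynomial.map_mul, ← hνf] at hβ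
    have hcc : (C c⁻¹ : K[X]) * C c = 1 := by rw [← Polynomial.C_mul, inv_mul_cancel₀ hc, C_1]
    apply mul_right_cancel₀ hf
    rw [Polynomial.C_mul]
    linear_combination (C c⁻¹) * hβ - h.map (algebraMap R K) * f * hcc
  have : IsUnit α.leadingCoeff :=
    isUnit_of_dvd_one (hh.leadingCoeff ▸ leadingCoeff_dvd_leadingCoeff hαh)
  rw [leadingCoeff_mul]
  exact (associated_mul_unit_right _ _ this)

end Gauss

/-! ### Coefficients and orders of difference operators -/

section Basic

variable {F : Type*} [Field F]

/-- Taking the `n`-th coefficient, as an additive map. -/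
def coeffHom (n : ℕ) : Operators F →+ RatFunc F where
  toFun z := z.coeff n
  map_zero' := rfl
  map_add' _ _ := by simp

theorem phi_iterate (k : ℕ) (r : RatFunc F) :
    (SkewPolynomial.φ)^[k] r = (shiftAut F ^ k) r := by
  rw [SkewPolynomial.φ_iterate_apply]
  rfl

@[elab_as_elim]
theorem operator_induction {P : Operators F → Prop} (z : Operators F) (h0 : P 0)
    (hadd : ∀ z w, P z → P w → P (z + w)) (hmon : ∀ n r, P (SkewPolynomial.monomial n r)) : P z :=
  SkewPolynomial.induction z h0 fun n r _ _ _ hq => hadd _ _ (hmon n r) hq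

theorem coeff_monomial_mul (k n : ℕ) (r : RatFunc F) (z : Operators F) :
    (SkewPolynomial.monomial k r * z).coeff n =
      if k ≤ n then r * (shiftAut F ^ k) (z.coeff (n - k)) else 0 := by
  induction z using operator_induction with
  | h0 => simp
  | hadd z w hz hw =>
    rw [mul_add, SkewPolynomial.coeff_add, hz, hw, SkewPolynomial.coeff_add]
    split_ifs <;> simp [mul_add]
  | hmon m s =>
    rw [SkewPolynomial.monomial_mul_monomial, phi_iterate, SkewPolynomial.coeff_monomial,
      SkewPolynomial.coeff_monomial]
    split_ifs <;> first | rfl | omega | simp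

theorem coeff_monomial_mul_add (k n : ℕ) (r : RatFunc F) (z : Operators F) :
    (SkewPolynomial.monomial k r * z).coeff (n + k) = r * (shiftAut F ^ k) (z.coeff n) := by
  simp [coeff_monomial_mul]

theorem coeff_C_mul' (n : ℕ) (r : RatFunc F) (z : Operators F) :
    (SkewPolynomial.C r * z).coeff n = r * z.coeff n := by
  simpa using coeff_monomial_mul_add 0 n r z

theorem coeff_eq_zero_of_ord_lt {z : Operators F} {n : ℕ} (h : ord z < n) : z.coeff n = 0 := by
  by_contra hn
  exact absurd (Finset.le_sup (f := id) (SkewPolynomial.mem_support_iff.mpr hn)) (not_le.mpr h)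

theorem coeff_ord_ne_zero {z : Operators F} (h : z ≠ 0) : z.coeff (ord z) ≠ 0 := by
  have hne : z.support.Nonempty :=
    Finset.nonempty_iff_ne_empty.mpr (mt SkewPolynomial.support_eq_empty.mp h)
  obtain ⟨i, hi, h⟩ := Finset.exists_mem_eq_sup z.support hne id
  rw [ord, h]
  exact SkewPolynomial.mem_support_iff.mp hi

theorem ord_eq_of_coeff {z : Operators F} {k : ℕ} (hk : z.coeff k ≠ 0)
    (h : ∀ i, k < i → z.coeff i = 0) : ord z = k := by
  refine le_antisymm (not_lt.mp fun hlt => ?_)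
    (not_lt.mp fun hlt => hk (coeff_eq_zero_of_ord_lt hlt))
  refine coeff_ord_ne_zero ?_ (h _ hlt)
  rintro rfl
  exact hk rfl

theorem mul_eq_sum (z w : Operators F) :
    z * w = ∑ k ∈ z.support, SkewPolynomial.monomial k (z.coeff k) * w := by
  conv_lhs => rw [← z.sum_monomial, SkewPolynomial.sum_def, Finset.sum_mul]

theorem coeff_mul_ord_add_ord (z w : Operators F) :
    (z * w).coeff (ord z + ord w) =
      z.coeff (ord z) * (shiftAut F ^ ord z) (w.coeff (ord w)) := by
  rw [mul_eq_sum]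
  change coeffHom (F := F) _ _ = _
  rw [map_sum, Finset.sum_eq_single (ord z)]
  · change SkewPolynomial.coeff _ _ = _
    rw [add_comm, coeff_monomial_mul_add]
  · intro k hk hkz
    have : k ≤ ord z := Finset.le_sup (f := id) hk
    change (_ : Operators F).coeff _ = 0
    rw [coeff_monomial_mul, if_pos (by omega),
      coeff_eq_zero_of_ord_lt (z := w) (by omega), map_zero, mul_zero]
  · intro h
    rw [SkewPolynomial.notMem_support_iff.mp h]
    simp

instance : NoZeroDivisors (Operators F) := by
  refine ⟨fun {z w} h => ?_⟩
  by_contra! hne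
  have := coeff_mul_ord_add_ord z w
  rw [h, SkewPolynomial.coeff_zero] at this
  exact mul_ne_zero (coeff_ord_ne_zero hne.1)
    ((map_ne_zero_iff _ (shiftAut F ^ ord z).injective).mpr (coeff_ord_ne_zero hne.2)) this.symm

theorem shiftAut_pow_algebraMap (k : ℕ) (f : F[X]) :
    (shiftAut F ^ k) (algebraMap F[X] (RatFunc F) f)
      = algebraMap F[X] (RatFunc F) (f.comp (X + C (k : F))) := by
  induction k with
  | zero => simp
  | succ k ih =>
    rw [pow_succ', RingAut.mul_apply, ih, shiftAut_algebraMap, comp_assoc]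
    congr 2
    simp only [add_comp, X_comp, C_comp, Nat.cast_succ, C_add, C_1]
    ring

/-- The reason `τ^p` commutes with `F(x)`: the shift `X + p` is `X`, and an endomorphism of `F(x)`
is determined on polynomials. -/
theorem shiftAut_pow_char (p : ℕ) [CharP F p] : shiftAut F ^ p = 1 := by
  have h : ((shiftAut F ^ p : RingAut (RatFunc F)) : RatFunc F →+* RatFunc F) = RingHom.id _ := by
    refine IsLocalization.ringHom_ext (nonZeroDivisors F[X]) (RingHom.ext fun f => ?_)
    change (shiftAut F ^ p) _ = _
    simp [shiftAut_pow_algebraMap, -RingAut.coe_pow]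
  ext1 r
  exact RingHom.congr_fun h r

end Basic

/-! ### Operators as a free module over `F(x)[τ^p]` -/

section Vector

variable (p : ℕ) [Fact p.Prime] {F : Type*} [Field F] [CharP F p]

/-- The coordinates of an operator with respect to the basis `1, τ, …, τ^(p-1)` over the
commutative polynomial ring `F(x)[τ^p]`. -/
def toVec (z : Operators F) : Fin p → (RatFunc F)[X] := fun i =>
  ∑ a ∈ Finset.range (ord z + 1), monomial a (z.coeff (p * a + i))

omit [CharP F p] in
theorem coeff_toVec (z : Operators F) (i : Fin p) (a : ℕ) :
    (toVec p z i).coeff a = z.coeff (p * a + i) := by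
  simp only [toVec, finsetSum_coeff, coeff_monomial, Finset.sum_ite_eq', Finset.mem_range]
  split_ifs with h
  · rfl
  · refine (coeff_eq_zero_of_ord_lt ?_).symm
    have := Nat.le_mul_of_pos_left a (Fact.out : p.Prime).pos
    omega

omit [CharP F p] in
theorem toVec_add (z w : Operators F) : toVec p (z + w) = toVec p z + toVec p w := by
  ext i a
  simp [coeff_toVec]

omit [CharP F p] in
theorem toVec_zero : toVec p (0 : Operators F) = 0 := by
  ext i a
  simp [coeff_toVec]

theorem toVec_monomial_mul (a : ℕ) (r : RatFunc F) (z : Operators F) :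
    toVec p (SkewPolynomial.monomial (p * a) r * z) = (C r * X ^ a) • toVec p z := by
  ext i b
  rw [coeff_toVec, coeff_monomial_mul, Pi.smul_apply, smul_eq_mul, mul_assoc, coeff_C_mul,
    coeff_X_pow_mul', pow_mul, shiftAut_pow_char, one_pow, coeff_toVec]
  have hp := (Fact.out : p.Prime).pos
  by_cases hab : a ≤ b
  · obtain ⟨c, rfl⟩ := Nat.exists_eq_add_of_le hab
    rw [if_pos hab, if_pos (by nlinarith)]
    simp only [mul_add, Nat.add_sub_cancel_left, add_assoc, RingAut.one_apply]
  · rw [if_neg hab, if_neg, mul_zero]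
    have : p * (b + 1) ≤ p * a := Nat.mul_le_mul_left p (by omega)
    have := i.2
    rw [mul_add] at *
    omega

omit [CharP F p] in
theorem toVec_monomial_one (l : Fin p) :
    toVec p (SkewPolynomial.monomial (l : ℕ) 1 : Operators F) = Pi.single l 1 := by
  ext i a
  rw [coeff_toVec, SkewPolynomial.coeff_monomial, Pi.single_apply]
  have hl := l.2
  have hi := i.2
  rcases Nat.eq_zero_or_pos a with rfl | ha
  · by_cases h : i = l
    · simp [h]
    · have : (l : ℕ) ≠ i := fun h' => h (Fin.ext h'.symm)
      simp [h, this]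
  · have := Nat.le_mul_of_pos_right p ha
    rw [if_neg (by omega)]
    split_ifs <;> simp [coeff_one, ha.ne']

theorem toVec_surjective : Function.Surjective (toVec p : Operators F → _) := by
  intro v
  have hz : ∀ (i : Fin p) (f : (RatFunc F)[X]), ∃ z : Operators F, toVec p z = Pi.single i f := by
    intro i f
    induction f using Polynomial.induction_on' with
    | add f g hf hg =>
      obtain ⟨z, hz⟩ := hf
      obtain ⟨w, hw⟩ := hg
      exact ⟨z + w, by rw [toVec_add, hz, hw, Pi.single_add]⟩
    | monomial a r =>
      refine ⟨SkewPolynomial.monomial (p * a) r * SkewPolynomial.monomial (i : ℕ) 1, ?_⟩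
      rw [toVec_monomial_mul, toVec_monomial_one, C_mul_X_pow_eq_monomial, ← Pi.single_smul,
        smul_eq_mul, mul_one]
  choose z hz using fun i => hz i (v i)
  refine ⟨∑ i, z i, ?_⟩
  have : ∀ s : Finset (Fin p), toVec p (∑ i ∈ s, z i) = ∑ i ∈ s, toVec p (z i) := fun s =>
    map_sum (⟨⟨toVec p, toVec_zero p⟩, toVec_add p⟩ : Operators F →+ _) z s
  rw [this, Finset.sum_congr rfl fun i _ => hz i, Finset.univ_sum_single]

/-- The matrix of right multiplication by `L` on `F(x)[τ]`, viewed as a module over `F(x)[τ^p]`;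
its determinant is the reduced norm of `L`. -/
def mulRightMatrix (L : Operators F) : Matrix (Fin p) (Fin p) (RatFunc F)[X] :=
  Matrix.of fun l => toVec p (SkewPolynomial.monomial (l : ℕ) 1 * L)

theorem toVec_mul (A L : Operators F) : toVec p (A * L) = toVec p A ᵥ* mulRightMatrix p L := by
  induction A using operator_induction with
  | h0 => simp [toVec_zero]
  | hadd z w hz hw => rw [add_mul, toVec_add, toVec_add, hz, hw, add_vecMul]
  | hmon n r =>
    have hp := (Fact.out : p.Prime).pos
    have : (SkewPolynomial.monomial n r : Operators F) = SkewPolynomial.monomial (p * (n / p)) r *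
        SkewPolynomial.monomial ((⟨n % p, Nat.mod_lt n hp⟩ : Fin p) : ℕ) 1 := by
      rw [SkewPolynomial.monomial_mul_monomial, iterate_map_one, mul_one, Nat.div_add_mod]
    rw [this, mul_assoc, toVec_monomial_mul, toVec_monomial_mul, toVec_monomial_one, smul_vecMul,
      single_one_vecMul]
    rfl

theorem mulRightMatrix_mul (A L : Operators F) :
    mulRightMatrix p (A * L) = mulRightMatrix p A * mulRightMatrix p L := by
  ext1 i j
  rw [mulRightMatrix, of_apply, ← mul_assoc, toVec_mul]
  rfl

omit [CharP F p] in
theorem mulRightMatrix_add (A L : Operators F) :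
    mulRightMatrix p (A + L) = mulRightMatrix p A + mulRightMatrix p L := by
  ext1 i j
  rw [mulRightMatrix, of_apply, mul_add, toVec_add]
  rfl

omit [CharP F p] in
theorem mulRightMatrix_one : mulRightMatrix p (1 : Operators F) = 1 := by
  ext1 i j
  rw [mulRightMatrix, of_apply, mul_one, toVec_monomial_one, Matrix.one_apply, Pi.single_apply]
  simp [eq_comm]

/-- Right multiplication matrices, as a ring homomorphism. -/
def mulRightHom : Operators F →+* Matrix (Fin p) (Fin p) (RatFunc F)[X] where
  toFun := mulRightMatrix p
  map_one' := mulRightMatrix_one p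
  map_mul' := mulRightMatrix_mul p
  map_zero' := by
    ext1 i j
    rw [mulRightMatrix, of_apply, mul_zero, toVec_zero]
    rfl
  map_add' := mulRightMatrix_add p

end Vector

/-! ### The ideal of shifted leading coefficients -/

section LeadingCoefficients

variable {F : Type*} [Field F]

theorem IsPolynomialOp.add {z w : Operators F} (hz : IsPolynomialOp z) (hw : IsPolynomialOp w) :
    IsPolynomialOp (z + w) := fun i => by
  obtain ⟨a, ha⟩ := hz i
  obtain ⟨b, hb⟩ := hw i
  exact ⟨a + b, by rw [SkewPolynomial.coeff_add, ha, hb, map_add]⟩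

theorem IsPolynomialOp.monomial_mul {z : Operators F} (hz : IsPolynomialOp z) (k : ℕ) (f : F[X]) :
    IsPolynomialOp (SkewPolynomial.monomial k (algebraMap F[X] (RatFunc F) f) * z) := fun i => by
  obtain ⟨a, ha⟩ := hz (i - k)
  rw [coeff_monomial_mul, ha, shiftAut_pow_algebraMap]
  split_ifs
  · exact ⟨f * a.comp (X + C (k : F)), by rw [map_mul]⟩
  · exact ⟨0, by rw [map_zero]⟩

/-- Some left multiple of `L` in `F[x][τ]` has vanishing coefficients beyond the `k`-th, which is
`f(x + k)`. -/
def IsLeadAt (L : Operators F) (k : ℕ) (f : F[X]) : Prop :=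
  ∃ A : Operators F, IsPolynomialOp (A * L) ∧ (∀ i, k < i → (A * L).coeff i = 0) ∧
    (A * L).coeff k = algebraMap F[X] (RatFunc F) (f.comp (X + C (k : F)))

theorem IsLeadAt.add {L : Operators F} {k : ℕ} {f g : F[X]} (hf : IsLeadAt L k f)
    (hg : IsLeadAt L k g) : IsLeadAt L k (f + g) := by
  obtain ⟨A, h1, h2, h3⟩ := hf
  obtain ⟨B, h1', h2', h3'⟩ := hg
  refine ⟨A + B, ?_, fun i hi => ?_, ?_⟩ <;> rw [add_mul]
  · exact h1.add h1'
  · rw [SkewPolynomial.coeff_add, h2 i hi, h2' i hi, add_zero]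
  · rw [SkewPolynomial.coeff_add, h3, h3', add_comp, map_add]

theorem IsLeadAt.mul {L : Operators F} {k : ℕ} {f : F[X]} (g : F[X]) (hf : IsLeadAt L k f) :
    IsLeadAt L k (g * f) := by
  obtain ⟨A, h1, h2, h3⟩ := hf
  refine ⟨SkewPolynomial.C (algebraMap F[X] (RatFunc F) (g.comp (X + C (k : F)))) * A, ?_,
    fun i hi => ?_, ?_⟩ <;> rw [mul_assoc]
  · exact h1.monomial_mul 0 _
  · rw [coeff_C_mul', h2 i hi, mul_zero]
  · rw [coeff_C_mul', h3, mul_comp, map_mul]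

/-- Left multiplication by `τ` shifts the top coefficient by one, exactly as the normalisation `f(x
+ k)` prescribes. Hence witnesses at different orders can be brought to a common one and added. -/
theorem IsLeadAt.succ {L : Operators F} {k : ℕ} {f : F[X]} (hf : IsLeadAt L k f) :
    IsLeadAt L (k + 1) f := by
  obtain ⟨A, h1, h2, h3⟩ := hf
  refine ⟨SkewPolynomial.monomial 1 1 * A, ?_, fun i hi => ?_, ?_⟩ <;> rw [mul_assoc]
  · simpa using h1.monomial_mul 1 1
  · rw [coeff_monomial_mul, h2 (i - 1) (by omega)]
    simp
  · rw [coeff_monomial_mul_add, h3, one_mul, shiftAut_pow_algebraMap, comp_assoc]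
    congr 2
    simp only [add_comp, X_comp, C_comp, Nat.cast_succ, C_add, Nat.cast_zero, C_0]
    ring

theorem IsLeadAt.mono {L : Operators F} {k l : ℕ} {f : F[X]} (hf : IsLeadAt L k f) (h : k ≤ l) :
    IsLeadAt L l f := by
  induction l, h using Nat.le_induction with
  | base => exact hf
  | succ l _ ih => exact ih.succ

theorem isLeadAt_zero (L : Operators F) (k : ℕ) : IsLeadAt L k 0 :=
  ⟨0, fun i => ⟨0, by simp⟩, fun i _ => by simp, by simp⟩

/-- The ideal of all shifted leading coefficients of left multiples of `L` in `F[x][τ]`. -/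
def leadIdeal (L : Operators F) : Ideal F[X] where
  carrier := {f | ∃ k, IsLeadAt L k f}
  zero_mem' := ⟨0, isLeadAt_zero L 0⟩
  add_mem' := by
    rintro f g ⟨k, hf⟩ ⟨l, hg⟩
    exact ⟨max k l, (hf.mono (le_max_left _ _)).add (hg.mono (le_max_right _ _))⟩
  smul_mem' := by
    rintro g f ⟨k, hf⟩
    exact ⟨k, hf.mul g⟩

theorem makeMonic_monic {f : F[X]} (hf : f ≠ 0) : (makeMonic f).Monic := by
  rw [makeMonic, mul_comm]
  exact monic_mul_leadingCoeff_inv hf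

theorem C_leadingCoeff_mul_makeMonic (f : F[X]) : C f.leadingCoeff * makeMonic f = f := by
  by_cases hf : f = 0
  · simp [hf]
  · rw [makeMonic, ← mul_assoc, ← C_mul, mul_inv_cancel₀ (leadingCoeff_ne_zero.mpr hf), C_1,
      one_mul]

theorem comp_sub_comp_add (a : F[X]) (c : F) : (a.comp (X - C c)).comp (X + C c) = a := by
  rw [comp_assoc]
  simp

theorem comp_add_comp_sub (a : F[X]) (c : F) : (a.comp (X + C c)).comp (X - C c) = a := by
  rw [comp_assoc]
  simp

/-- The leading coefficients already form an ideal; the span only restores the constant factors lost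
in `makeMonic`. This provides a single left multiple of `L` realising `lcInf L`. -/
theorem lcIdeal_eq (L : Operators F) : lcIdeal L = leadIdeal L := by
  apply le_antisymm
  · refine Ideal.span_le.mpr (Set.iUnion_subset fun k => ?_)
    rintro f (rfl | ⟨A, hA, -, rfl⟩)
    · exact (leadIdeal L).zero_mem
    · refine (leadIdeal L).mul_mem_left _ ⟨ord (A * L), A, hA, fun i hi =>
        coeff_eq_zero_of_ord_lt hi, ?_⟩
      obtain ⟨a, ha⟩ := hA (ord (A * L))
      rw [comp_sub_comp_add, ha, RatFunc.num_algebraMap]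
  · rintro f ⟨k, A, hA, h1, h2⟩
    by_cases hf : f = 0
    · rw [hf]
      exact (lcIdeal L).zero_mem
    have hk : (A * L).coeff k ≠ 0 := by
      rw [h2]
      intro h
      rw [map_eq_zero_iff _ (IsFractionRing.injective F[X] (RatFunc F))] at h
      rw [← comp_add_comp_sub f k, h, zero_comp] at hf
      exact hf rfl
    have hord := ord_eq_of_coeff hk h1
    have hlc : lc (A * L) = makeMonic f := by
      rw [lc, hord, h2, RatFunc.num_algebraMap, comp_add_comp_sub]
    rw [← C_leadingCoeff_mul_makeMonic f, ← hlc]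
    exact Ideal.mul_mem_left _ _ (Ideal.subset_span
      (Set.mem_iUnion.mpr ⟨ord A, Or.inr ⟨A, hA, rfl, rfl⟩⟩))

theorem leadIdeal_ne_bot {L : Operators F} (hL : L ≠ 0) : leadIdeal L ≠ ⊥ := by
  obtain ⟨c, hc⟩ := IsLocalization.exist_integer_multiples (nonZeroDivisors F[X])
    (Finset.range (ord L + 1)) fun i => L.coeff i
  let z : Operators F := SkewPolynomial.C (algebraMap F[X] (RatFunc F) c) * L
  have hz : ∀ i, z.coeff i = algebraMap F[X] (RatFunc F) c * L.coeff i := fun i =>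
    coeff_C_mul' _ _ _
  have hpoly : IsPolynomialOp z := fun i => by
    by_cases hi : i ≤ ord L
    · obtain ⟨a, ha⟩ := hc i (by simpa [Nat.lt_succ_iff] using hi)
      exact ⟨a, by rw [hz, ha]; exact (Algebra.smul_def _ _).symm⟩
    · exact ⟨0, by rw [hz, coeff_eq_zero_of_ord_lt (not_le.mp hi), mul_zero, map_zero]⟩
  obtain ⟨a, ha⟩ := hpoly (ord L)
  rw [Submodule.ne_bot_iff]
  refine ⟨a.comp (X - C (ord L : F)), ⟨ord L, SkewPolynomial.C (algebraMap F[X] (RatFunc F) c),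
    hpoly, fun i hi => (hz i).trans ?_, ?_⟩, fun h => ?_⟩
  · rw [coeff_eq_zero_of_ord_lt hi, mul_zero]
  · rw [comp_sub_comp_add]; exact ha
  · have h0 : a = 0 := by rw [← comp_sub_comp_add a (ord L : F), h, zero_comp]
    rw [h0, map_zero, hz] at ha
    refine mul_ne_zero ?_ (coeff_ord_ne_zero hL) ha
    simp

theorem lcInf_monic {L : Operators F} (hL : L ≠ 0) : (lcInf L).Monic := by
  refine makeMonic_monic fun h => leadIdeal_ne_bot hL ?_
  rwa [← lcIdeal_eq, Submodule.IsPrincipal.eq_bot_iff_generator_eq_zero]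

theorem lcInf_mem (L : Operators F) : ∃ k, IsLeadAt L k (lcInf L) := by
  have : lcInf L ∈ leadIdeal L := by
    rw [← lcIdeal_eq]
    exact Ideal.mul_mem_left _ _ (Submodule.IsPrincipal.generator_mem _)
  exact this

theorem lcInf_dvd {L : Operators F} {k : ℕ} {f : F[X]} (h : IsLeadAt L k f) : lcInf L ∣ f := by
  have hf : f ∈ lcIdeal L := by
    rw [lcIdeal_eq]
    exact ⟨k, h⟩
  rw [Submodule.IsPrincipal.mem_iff_generator_dvd] at hf
  refine dvd_trans ⟨C (Submodule.IsPrincipal.generator (lcIdeal L)).leadingCoeff, ?_⟩ hf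
  rw [mul_comm]
  exact (C_leadingCoeff_mul_makeMonic _).symm

end LeadingCoefficients

/-! ### Right division and the Bézout identity -/

section Division

variable {F : Type*} [Field F]

theorem exists_right_division (L : Operators F) (hL : L ≠ 0) (N : ℕ) :
    ∀ z : Operators F, (∀ i, N ≤ i → z.coeff i = 0) →
      ∃ Q : Operators F, ∀ i, ord L ≤ i → (z - Q * L).coeff i = 0 := by
  induction N with
  | zero => exact fun z hz => ⟨0, fun i _ => by simpa using hz i (Nat.zero_le i)⟩
  | succ N ih =>
    intro z hz
    by_cases hN : N < ord L
    · exact ⟨0, fun i hi => by simpa using hz i (by omega)⟩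
    obtain ⟨k, rfl⟩ := Nat.exists_eq_add_of_le' (not_lt.mp hN)
    set c := (shiftAut F ^ k) (L.coeff (ord L)) with hc
    have hc0 : c ≠ 0 :=
      (map_ne_zero_iff _ (shiftAut F ^ k).injective).mpr (coeff_ord_ne_zero hL)
    set q : Operators F := SkewPolynomial.monomial k (z.coeff (k + ord L) / c) with hq
    obtain ⟨Q, hQ⟩ := ih (z - q * L) fun i hi => by
      rw [SkewPolynomial.coeff_sub]
      rcases hi.eq_or_lt with rfl | hi
      · rw [add_comm k, hq, coeff_monomial_mul_add, ← hc, add_comm k, div_mul_cancel₀ _ hc0,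
          sub_self]
      · rw [hz i hi, hq, coeff_monomial_mul, coeff_eq_zero_of_ord_lt (z := L) (by omega)]
        simp
    exact ⟨q + Q, fun i hi => by rw [add_mul, ← sub_sub]; exact hQ i hi⟩

/-- The Bézout identity for operators whose greatest common right divisor is `1`. -/
theorem exists_bezout {L₁ L₂ : Operators F} (hL₁ : L₁ ≠ 0) (h : IsGCRD 1 L₁ L₂) :
    ∃ U V : Operators F, U * L₁ + V * L₂ = 1 := by
  let S : Ideal (Operators F) := Ideal.span {L₁, L₂}
  have hS : ∃ n G, G ∈ S ∧ G ≠ 0 ∧ ord G = n :=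
    ⟨_, L₁, Ideal.subset_span (by simp), hL₁, rfl⟩
  classical
  obtain ⟨G, hGS, hG0, hGn⟩ := Nat.find_spec hS
  have hdvd : ∀ M ∈ S, RightDvd G M := fun M hM => by
    obtain ⟨Q, hQ⟩ := exists_right_division G hG0 (ord M + 1) M fun i hi =>
      coeff_eq_zero_of_ord_lt hi
    refine ⟨Q, ?_⟩
    by_contra hne
    have hne' : M - Q * G ≠ 0 := sub_ne_zero.mpr hne
    have hlt : ord (M - Q * G) < ord G := by
      by_contra hle
      exact coeff_ord_ne_zero hne' (hQ _ (not_lt.mp hle))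
    rw [hGn] at hlt
    exact Nat.find_min hS hlt ⟨_, S.sub_mem hM (S.mul_mem_left _ hGS), hne', rfl⟩
  obtain ⟨W, hW⟩ := h.2.2 G (hdvd _ (Ideal.subset_span (by simp)))
    (hdvd _ (Ideal.subset_span (by simp)))
  have h1 : (1 : Operators F) ∈ S := hW ▸ S.mul_mem_left W hGS
  exact Ideal.mem_span_pair.mp h1

end Division

/-! ### Leading coefficient of the primitive reduced norm -/

section ReducedNorm

variable (p : ℕ) [Fact p.Prime] {F : Type*} [Field F]

theorem exists_map_eq_toVec {z : Operators F} (hz : IsPolynomialOp z) :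
    ∃ w : Fin p → F[X][X], ∀ i, (w i).map (algebraMap F[X] (RatFunc F)) = toVec p z i := by
  have : ∀ i, toVec p z i ∈ lifts (algebraMap F[X] (RatFunc F)) := fun i => by
    rw [lifts_iff_coeff_lifts]
    intro a
    obtain ⟨f, hf⟩ := hz (p * a + i)
    exact ⟨f, by rw [coeff_toVec, hf]⟩
  choose w hw using fun i => (mem_lifts _).mp (this i)
  exact ⟨w, hw⟩

theorem coeff_of_map_eq_toVec {z : Operators F} {w : Fin p → F[X][X]}
    (h : ∀ i, (w i).map (algebraMap F[X] (RatFunc F)) = toVec p z i) (i : Fin p) (a : ℕ) :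
    z.coeff (p * a + i) = algebraMap F[X] (RatFunc F) ((w i).coeff a) := by
  rw [← coeff_toVec, ← h, coeff_map]

theorem coeff_of_map_eq_toVec' {z : Operators F} {w : Fin p → F[X][X]}
    (h : ∀ i, (w i).map (algebraMap F[X] (RatFunc F)) = toVec p z i) (n : ℕ) :
    z.coeff n = algebraMap F[X] (RatFunc F)
      ((w ⟨n % p, Nat.mod_lt n (Fact.out : p.Prime).pos⟩).coeff (n / p)) := by
  rw [← coeff_of_map_eq_toVec p h, Nat.div_add_mod]

/-- The vectors over `F[x][X]` that lie in the row space of a matrix over `F(x)[X]`. -/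
def integralRows (A : Matrix (Fin p) (Fin p) (RatFunc F)[X]) :
    Submodule F[X][X] (Fin p → F[X][X]) where
  carrier := {w | ∃ v : Fin p → (RatFunc F)[X],
    ∀ i, (w i).map (algebraMap F[X] (RatFunc F)) = (v ᵥ* A) i}
  zero_mem' := ⟨0, by simp⟩
  add_mem' := by
    rintro w w' ⟨v, hv⟩ ⟨v', hv'⟩
    exact ⟨v + v', fun i => by simp [hv, hv', add_vecMul]⟩
  smul_mem' := by
    rintro c w ⟨v, hv⟩
    exact ⟨c.map (algebraMap F[X] (RatFunc F)) • v, fun i => by simp [hv, smul_vecMul]⟩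

omit [Fact p.Prime] in
theorem mem_integralRows_of_C_smul (A : Matrix (Fin p) (Fin p) (RatFunc F)[X]) (r : F[X])
    (w : Fin p → F[X][X]) (hr : r ≠ 0) (h : C r • w ∈ integralRows p A) :
    w ∈ integralRows p A := by
  obtain ⟨v, hv⟩ := h
  have hr' : algebraMap F[X] (RatFunc F) r ≠ 0 := by simpa using hr
  refine ⟨C (algebraMap F[X] (RatFunc F) r)⁻¹ • v, fun i => ?_⟩
  rw [smul_vecMul, Pi.smul_apply, ← hv i, Pi.smul_apply, smul_eq_mul, smul_eq_mul,
    Polynomial.map_mul, map_C, ← mul_assoc, ← C_mul, inv_mul_cancel₀ hr', C_1, one_mul]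

variable [CharP F p]

/-- A family of integral rows whose leading terms have the orders `p * m + j` and the shifts of
`lcInf L` as coefficients reduces all integral rows to vectors of bounded degree. -/
theorem exists_degree_sub_lt (L : Operators F) (m : ℕ) (E : Matrix (Fin p) (Fin p) F[X][X])
    (hEM : ∀ j, E j ∈ integralRows p (mulRightMatrix p L))
    (hEz : ∀ (j i : Fin p) (b : ℕ), p * m + (j : ℕ) < p * b + (i : ℕ) → (E j i).coeff b = 0)
    (hEl : ∀ j, (E j j).coeff m = (lcInf L).comp (X + C ((j : ℕ) : F))) (N : ℕ) :
    ∀ w ∈ integralRows p (mulRightMatrix p L),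
      (∀ (i : Fin p) a, N ≤ p * a + i → (w i).coeff a = 0) →
      ∃ b : Fin p → F[X][X], ∀ j, ((w - b ᵥ* E) j).degree < m := by
  have hp := (Fact.out : p.Prime).pos
  induction N with
  | zero =>
    intro w _ hw
    refine ⟨0, fun j => ?_⟩
    have : w j = 0 := by
      ext1 a
      exact hw j a (Nat.zero_le _)
    simp [this]
  | succ N ih =>
    intro w hwM hw
    by_cases hN : N < p * m
    · refine ⟨0, fun j => ?_⟩
      rw [zero_vecMul, sub_zero, degree_lt_iff_coeff_zero]
      intro a ha
      have := Nat.mul_le_mul_left p ha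
      exact hw j a (by omega)
    set j : Fin p := ⟨N % p, Nat.mod_lt N hp⟩ with hj
    set a := N / p with ha
    have hNa : p * a + (j : ℕ) = N := Nat.div_add_mod N p
    have hma : m ≤ a := (Nat.le_div_iff_mul_le hp).mpr (by rw [mul_comm]; exact not_lt.mp hN)
    obtain ⟨d, hd⟩ := Nat.exists_eq_add_of_le' hma
    obtain ⟨q, hq⟩ : (lcInf L).comp (X + C ((j : ℕ) : F)) ∣ (w j).coeff a := by
      obtain ⟨v, hv⟩ := hwM
      obtain ⟨z, rfl⟩ := toVec_surjective p v
      rw [← toVec_mul] at hv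
      -- Since `N = p * a + j`, shifting by `N` and by `j` coincide in characteristic `p`.
      have hN' : ((j : ℕ) : F) = (N : F) := by rw [← hNa]; simp
      rw [hN']
      have hlead : IsLeadAt L N (((w j).coeff a).comp (X - C (N : F))) := by
        refine ⟨z, fun n => ⟨_, coeff_of_map_eq_toVec' p hv n⟩, fun n hn => ?_, ?_⟩
        · rw [coeff_of_map_eq_toVec' p hv n, hw _ _ (by simpa [Nat.div_add_mod] using hn),
            map_zero]
        · rw [comp_sub_comp_add, coeff_of_map_eq_toVec' p hv N]
      obtain ⟨q, hq⟩ := lcInf_dvd hlead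
      refine ⟨q.comp (X + C (N : F)), ?_⟩
      rw [← mul_comp, ← hq, comp_sub_comp_add]
    -- Row `j` has its top term at index `p * m + j`; multiplying by `T^d` with `a = m + d` moves it
    -- to `N`, where it cancels that of `w`.
    obtain ⟨b, hb⟩ := ih (w - (C q * X ^ d) • E j)
      (Submodule.sub_mem _ hwM (Submodule.smul_mem _ _ (hEM j))) fun i c hc => by
        rw [Pi.sub_apply, Pi.smul_apply, smul_eq_mul, coeff_sub, mul_assoc, coeff_C_mul,
          coeff_X_pow_mul']
        rcases hc.eq_or_lt with hc | hc
        · have hij : i = j := Fin.ext (by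
            have := congrArg (· % p) hc
            simpa [Nat.mod_eq_of_lt i.2, hj] using this.symm)
          subst hij
          have hca : c = a := Nat.eq_of_mul_eq_mul_left hp (by omega)
          rw [hca, hd, if_pos (Nat.le_add_right _ _), Nat.add_sub_cancel_left, hEl, ← hd, hq]
          ring
        · rw [hw i c hc]
          split_ifs with hdc
          · obtain ⟨e, rfl⟩ := Nat.exists_eq_add_of_le' hdc
            rw [Nat.add_sub_cancel, hEz j i e, mul_zero, sub_zero]
            rw [← hNa, hd, mul_add, mul_add] at hc
            omega
          · simp
    refine ⟨b + Pi.single j (C q * X ^ d), fun i => ?_⟩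
    have : w - (b + Pi.single j (C q * X ^ d)) ᵥ* E = w - (C q * X ^ d) • E j - b ᵥ* E := by
      rw [add_vecMul, single_vecMul, sub_add_eq_sub_sub_swap]
      rfl
    rw [this]
    exact hb i

/-- The primitive part of the reduced norm of `L` has the norm of `lcInf L` as its leading
coefficient. -/
theorem hasPrimitiveLead_det_mulRightMatrix {L : Operators F} (hL : L ≠ 0) :
    HasPrimitiveLead (mulRightMatrix p L).det
      (∏ j : Fin p, (lcInf L).comp (X + C ((j : ℕ) : F))) := by
  have hp := (Fact.out : p.Prime).pos
  have hinj := IsFractionRing.injective F[X] (RatFunc F)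
  obtain ⟨m, hm⟩ := lcInf_mem L
  have hlead : ∀ j : Fin p, IsLeadAt L (p * m + j) (lcInf L) := fun j =>
    hm.mono ((Nat.le_mul_of_pos_left m hp).trans (Nat.le_add_right _ _))
  choose A hA hAz hAl using hlead
  choose E hE using fun j => exists_map_eq_toVec p (hA j)
  have hEc := fun j => coeff_of_map_eq_toVec p (hE j)
  have hEz : ∀ (j i : Fin p) (b : ℕ), p * m + (j : ℕ) < p * b + (i : ℕ) → (E j i).coeff b = 0 := by
    intro j i b h
    apply hinj
    rw [← hEc, hAz j _ h, map_zero]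
  have hEl : ∀ j, (E j j).coeff m = (lcInf L).comp (X + C ((j : ℕ) : F)) := fun j => by
    apply hinj
    rw [← hEc, hAl]
    simp
  have hdeg : ∀ j i, (E j i).natDegree ≤ m := fun j i => by
    rw [natDegree_le_iff_coeff_eq_zero]
    intro b hb
    have := Nat.mul_le_mul_left p (Nat.succ_le_of_lt hb)
    rw [Nat.succ_eq_add_one, mul_add] at this
    exact hEz j i b (by omega)
  have hdet : ((Matrix.of E).map fun f => f.coeff m).det =
      ∏ j : Fin p, (lcInf L).comp (X + C ((j : ℕ) : F)) := by
    rw [det_of_isLowerTriangular]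
    · exact Finset.prod_congr rfl fun j _ => hEl j
    · intro j i hij
      exact hEz j i m (Nat.add_lt_add_left (Fin.lt_def.mp hij) _)
  have hdet0 : ((Matrix.of E).map fun f => f.coeff m).det ≠ 0 := by
    rw [hdet, Finset.prod_ne_zero_iff]
    intro j _
    exact ((lcInf_monic hL).comp (monic_X_add_C _)
      (by rw [natDegree_X_add_C]; exact one_ne_zero)).ne_zero
  have hEM : ∀ j, E j ∈ integralRows p (mulRightMatrix p L) := fun j =>
    ⟨toVec p (A j), fun i => by rw [hE, toVec_mul]⟩
  have hred : ∀ w ∈ integralRows p (mulRightMatrix p L),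
      ∃ b : Fin p → F[X][X], ∀ j, ((w - b ᵥ* Matrix.of E) j).degree < m := fun w hw => by
    refine exists_degree_sub_lt p L m (Matrix.of E) hEM hEz hEl
      (p * (∑ j, (w j).natDegree + 1)) w hw fun i a ha => ?_
    have h1 := Finset.single_le_sum (f := fun j => (w j).natDegree) (fun j _ => Nat.zero_le _)
      (Finset.mem_univ i)
    refine coeff_eq_zero_of_natDegree_lt (lt_of_le_of_lt h1 ?_)
    have h2 : p * (∑ j, (w j).natDegree + 1) < p * (a + 1) := by
      have := i.2
      rw [mul_add p a]
      omega
    have := Nat.lt_of_mul_lt_mul_left h2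
    omega
  have hprim := isPrimitive_det (Matrix.of E) m hdeg hdet0 _ hEM
    (mem_integralRows_of_C_smul p _) hred
  obtain ⟨h, hh, hrow⟩ := exists_monic_smul_mem_rows (Matrix.of E) m _ hEM hred
  -- The cleared matrix `B` of right multiplication has integral rows, so `h B = B' E`. Determinants
  -- give `c^p h^p` times the norm as `det B' * det E`, bounding `det E` from the other side.
  obtain ⟨c, B, hc, hB⟩ := exists_C_mul_matrix_eq_map (R := F[X]) (mulRightMatrix p L)
  have hBM : ∀ l, B l ∈ integralRows p (mulRightMatrix p L) := fun l =>
    ⟨Pi.single l (C (algebraMap F[X] (RatFunc F) c)), fun i => by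
      rw [single_vecMul]
      exact (congrFun (congrFun hB l) i).symm⟩
  choose B' hB' using fun l => hrow (B l) (hBM l)
  have hBE : h • B = Matrix.of B' * Matrix.of E := by
    ext1 l i
    exact congrFun (hB' l) i
  rw [← hdet, ← leadingCoeff_det (Matrix.of E) m hdeg hdet0]
  refine hasPrimitiveLead_of_mul (u := (Matrix.of fun j => toVec p (A j)).det)
    (c := algebraMap F[X] (RatFunc F) c ^ p) (β := (Matrix.of B').det) hprim ?_ (hh.pow p)
    (pow_ne_zero _ (by simpa using hc)) ?_
  · rw [← coe_mapRingHom, RingHom.map_det, ← det_mul]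
    congr 1
    ext1 j i
    change (E j i).map _ = _
    rw [hE, toVec_mul]
    rfl
  · have h1 := congrArg (fun M => (mapRingHom (algebraMap F[X] (RatFunc F))) M.det) hBE
    have h2 := congrArg Matrix.det hB
    simp only [det_smul, det_mul, map_mul, Fintype.card_fin, map_pow] at h1 h2
    rw [← RingHom.map_det] at h2
    rw [← h2] at h1
    simp only [coe_mapRingHom] at h1
    rw [← h1, Polynomial.map_pow, C_pow]
    ring

end ReducedNorm

/-! ### Hilbert 90 for the shift -/

section ShiftEquivalence

variable (p : ℕ) [Fact p.Prime] {F : Type*} [Field F] [CharP F p]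

omit [Fact p.Prime] in
theorem shiftAut_pow_injOn {i j : ℕ} (hi : i < p) (hj : j < p)
    (h : ∀ r : RatFunc F, (shiftAut F ^ i) r = (shiftAut F ^ j) r) : i = j := by
  have := h (algebraMap F[X] (RatFunc F) X)
  rw [shiftAut_pow_algebraMap, shiftAut_pow_algebraMap,
    (IsFractionRing.injective F[X] (RatFunc F)).eq_iff, X_comp, X_comp, add_right_inj,
    C_inj, CharP.cast_eq_iff_mod_eq F p, Nat.mod_eq_of_lt hi, Nat.mod_eq_of_lt hj] at this
  exact this

/-- Hilbert's Theorem 90 for the shift automorphism of `F(x)` in characteristic `p`. -/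
theorem exists_shiftAut_div_eq {r : RatFunc F}
    (hr : ∏ i ∈ Finset.range p, (shiftAut F ^ i) r = 1) :
    ∃ f : RatFunc F, f ≠ 0 ∧ r = shiftAut F f / f := by
  have hp := (Fact.out : p.Prime).pos
  let χ : Fin p → (RatFunc F →* RatFunc F) := fun i =>
    ((shiftAut F ^ (i : ℕ) : RingAut (RatFunc F)) : RatFunc F →* RatFunc F)
  have hχ : Function.Injective χ := fun i j h =>
    Fin.ext (shiftAut_pow_injOn p i.2 j.2 fun r => DFunLike.congr_fun h r)
  let c : ℕ → RatFunc F := fun i => ∏ j ∈ Finset.range i, (shiftAut F ^ j) r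
  let y : RatFunc F → RatFunc F := fun θ => ∑ i ∈ Finset.range p, c i * (shiftAut F ^ i) θ
  -- The Lagrange resolvent is not identically zero, by Dedekind's independence of the `p` distinct
  -- powers of the shift.
  obtain ⟨θ, hθ⟩ : ∃ θ, y θ ≠ 0 := by
    by_contra! hy
    have hli := (linearIndependent_monoidHom (RatFunc F) (RatFunc F)).comp χ hχ
    rw [Fintype.linearIndependent_iff] at hli
    have h0 := hli (fun i => c i) (funext fun θ => by
      have := hy θ
      simp only [y, Finset.sum_range] at this
      simpa [χ, Finset.sum_apply] using this) ⟨0, hp⟩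
    simp [c] at h0
  -- Each summand moves to the next one; the last returns to the first because the product `c p` is
  -- `1` and the shift has order `p`.
  have hσ : r * shiftAut F (y θ) = y θ := by
    have hstep : ∀ i, r * shiftAut F (c i * (shiftAut F ^ i) θ) =
        c (i + 1) * (shiftAut F ^ (i + 1)) θ := fun i => by
      simp only [c, Finset.prod_range_succ', pow_succ', RingAut.mul_apply, map_mul, map_prod,
        pow_zero, RingAut.one_apply]
      ring
    simp only [y, map_sum, Finset.mul_sum, hstep]
    have h1 := Finset.sum_range_succ (fun i => c i * (shiftAut F ^ i) θ) p
    rw [Finset.sum_range_succ'] at h1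
    refine add_right_cancel (b := c 0 * (shiftAut F ^ 0) θ) (h1.trans ?_)
    congr 1
    have hcp : c p = 1 := hr
    rw [shiftAut_pow_char, hcp]
    simp [c]
  refine ⟨(y θ)⁻¹, inv_ne_zero hθ, ?_⟩
  have hσ0 : shiftAut F (y θ) ≠ 0 := (map_ne_zero_iff _ (shiftAut F).injective).mpr hθ
  rw [map_inv₀, div_inv_eq_mul, ← div_eq_inv_mul, eq_div_iff hσ0, hσ]

theorem shiftEquivalent_of_prod_comp_eq {f g : F[X]} (hf : f ≠ 0) (hg : g ≠ 0)
    (h : ∏ j : Fin p, f.comp (X + C ((j : ℕ) : F)) = ∏ j : Fin p, g.comp (X + C ((j : ℕ) : F))) :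
    ShiftEquivalent (algebraMap F[X] (RatFunc F) f) (algebraMap F[X] (RatFunc F) g) := by
  have hinj := IsFractionRing.injective F[X] (RatFunc F)
  have hg' : algebraMap F[X] (RatFunc F) g ≠ 0 := (map_ne_zero_iff _ hinj).mpr hg
  refine ⟨(map_ne_zero_iff _ hinj).mpr hf, hg', exists_shiftAut_div_eq p ?_⟩
  simp only [map_div₀, Finset.prod_div_distrib, shiftAut_pow_algebraMap, ← map_prod]
  rw [Finset.prod_range, Finset.prod_range, h, div_self]
  rw [← h, map_ne_zero_iff _ hinj, h, Finset.prod_ne_zero_iff]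
  intro j _ h0
  rw [← comp_add_comp_sub g ((j : ℕ) : F), h0, zero_comp] at hg
  exact hg rfl

end ShiftEquivalence

/-! ### Norms of products and of least common left multiples -/

section Multiplicativity

variable (p : ℕ) [Fact p.Prime] {F : Type*} [Field F] [CharP F p]

theorem shiftEquivalent_of_hasPrimitiveLead {L L₁ L₂ : Operators F} (hL : L ≠ 0) (hL₁ : L₁ ≠ 0)
    (hL₂ : L₂ ≠ 0) {c : RatFunc F} (hc : c ≠ 0)
    (h : (mulRightMatrix p L).det = C c * ((mulRightMatrix p L₁).det * (mulRightMatrix p L₂).det)) :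
    ShiftEquivalent (algebraMap F[X] (RatFunc F) (lcInf L))
      (algebraMap F[X] (RatFunc F) (lcInf L₁ * lcInf L₂)) := by
  have h1 := ((hasPrimitiveLead_det_mulRightMatrix p hL₁).mul
    (hasPrimitiveLead_det_mulRightMatrix p hL₂)).C_mul hc
  rw [← h] at h1
  have h2 := (hasPrimitiveLead_det_mulRightMatrix p hL).associated h1
  have hm := lcInf_monic hL
  have hm₁ := lcInf_monic hL₁
  have hm₂ := lcInf_monic hL₂
  have hcomp : ∀ {g : F[X]} (j : Fin p), g.Monic → (g.comp (X + C ((j : ℕ) : F))).Monic :=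
    fun j hg => hg.comp (monic_X_add_C _) (by rw [natDegree_X_add_C]; exact one_ne_zero)
  refine shiftEquivalent_of_prod_comp_eq p hm.ne_zero (hm₁.mul hm₂).ne_zero ?_
  simp only [mul_comp, Finset.prod_mul_distrib]
  exact eq_of_monic_of_associated (monic_prod_of_monic _ _ fun j _ => hcomp j hm)
    ((monic_prod_of_monic _ _ fun j _ => hcomp j hm₁).mul
      (monic_prod_of_monic _ _ fun j _ => hcomp j hm₂)) h2

/-- The cofactor of `L₂` in a least common left multiple of `L₁` and `L₂`, where `L₁` and `L₂` are
right coprime, has the same reduced norm as `L₁` up to a unit. -/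
theorem exists_det_mulRightMatrix_eq {A B U V L₁ L₂ : Operators F} (hL₁ : L₁ ≠ 0) (hL₂ : L₂ ≠ 0)
    (hAB : A * L₂ = B * L₁) (hlcm : IsLCLM (A * L₂) L₁ L₂) (hUV : U * L₁ + V * L₂ = 1) :
    ∃ c : RatFunc F, c ≠ 0 ∧ (mulRightMatrix p A).det = C c * (mulRightMatrix p L₁).det := by
  have hdvd : ∀ W W' : Operators F, W * L₂ = W' * L₁ → ∃ s, s * A = W := fun W W' h => by
    obtain ⟨s, hs⟩ := hlcm.2.2 (W * L₂) ⟨W', h⟩ ⟨W, rfl⟩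
    exact ⟨s, mul_right_cancel₀ hL₂ (by rw [mul_assoc, hs])⟩
  -- Bézout turns `L₁ V L₂` and `(L₂ V - 1) L₂` into left multiples of `L₁`; the quotients `s`, `t`
  -- complete the column `(L₁, L₂)` to an inverse of the block matrix with rows `(U, V)` and `(B,
  -- -A)`.
  obtain ⟨s, hs⟩ := hdvd (L₁ * V) (1 - L₁ * U) (by
    rw [mul_assoc, eq_sub_of_add_eq' hUV]; noncomm_ring)
  obtain ⟨t, ht⟩ := hdvd (L₂ * V - 1) (-(L₂ * U)) (by
    rw [sub_mul, mul_assoc, eq_sub_of_add_eq' hUV]; noncomm_ring)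
  have h11 : L₁ * U + s * B = 1 := mul_right_cancel₀ hL₁ (by
    rw [add_mul, mul_assoc s, ← hAB, ← mul_assoc s, hs, mul_assoc, mul_assoc, ← mul_add, hUV,
      mul_one, one_mul])
  have h21 : L₂ * U + t * B = 0 := mul_right_cancel₀ hL₁ (by
    rw [add_mul, mul_assoc t, ← hAB, ← mul_assoc t, ht, sub_mul, mul_assoc, mul_assoc,
      ← add_sub_assoc, ← mul_add, hUV, mul_one, one_mul, sub_self, zero_mul])
  let ρ := mulRightHom p (F := F)
  have hinv : fromBlocks (ρ L₁) (ρ s) (ρ L₂) (ρ t) * fromBlocks (ρ U) (ρ V) (ρ B) (-ρ A) = 1 := by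
    rw [fromBlocks_multiply, ← map_neg]
    simp only [← map_mul, ← map_add, mul_neg, h11, h21, hs, ht, ← sub_eq_add_neg, sub_self,
      sub_sub_cancel, map_one, map_zero, fromBlocks_one]
  -- Taking determinants here compares the norm of `L₁` with that of `-A`; the factor between them
  -- is a unit of `F(x)[T]`, hence a nonzero constant.
  have hmul : fromBlocks (ρ U) (ρ V) (ρ B) (-ρ A) * fromBlocks (ρ L₁) 0 (ρ L₂) 1 =
      fromBlocks 1 (ρ V) 0 (-ρ A) := by
    rw [fromBlocks_multiply]
    simp only [mul_zero, zero_add, mul_one, neg_mul, ← map_mul, ← map_add, hUV, hAB,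
      add_neg_cancel, map_one]
  have hunit := IsUnit.of_mul_eq_one_right _ ((det_mul _ _).symm.trans
    ((congrArg det hinv).trans det_one))
  have hdet := (det_mul _ _).symm.trans (congrArg det hmul)
  rw [det_fromBlocks_zero₁₂, det_fromBlocks_zero₂₁, det_one, mul_one, one_mul, det_neg,
    Fintype.card_fin] at hdet
  obtain ⟨c, hc, hcdet⟩ := Polynomial.isUnit_iff.mp hunit
  rw [← hcdet] at hdet
  refine ⟨(-1) ^ p * c, mul_ne_zero (pow_ne_zero _ (by simp)) hc.ne_zero, ?_⟩
  change (ρ A).det = C _ * (ρ L₁).det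
  rw [C_mul, mul_assoc, hdet, ← mul_assoc]
  simp [← mul_pow]

end Multiplicativity

end ShiftOperator

end

theorem mainTheorem3 (p : ℕ) [Fact p.Prime] (F : Type*) [Field F] [CharP F p]
    (L L₁ L₂ : ShiftOperator.Operators F) (hL₁ : L₁ ≠ 0) (hL₂ : L₂ ≠ 0)
    (hL : L = L₁ * L₂ ∨
      (ShiftOperator.IsLCLM L L₁ L₂ ∧ ShiftOperator.IsGCRD 1 L₁ L₂)) :
    ShiftOperator.ShiftEquivalent
      (algebraMap (Polynomial F) (RatFunc F) (ShiftOperator.lcInf L))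
      (algebraMap (Polynomial F) (RatFunc F)
        (ShiftOperator.lcInf L₁ * ShiftOperator.lcInf L₂)) := by
  rcases hL with rfl | ⟨hlcm, hgcd⟩
  · refine ShiftOperator.shiftEquivalent_of_hasPrimitiveLead p (mul_ne_zero hL₁ hL₂) hL₁ hL₂
      one_ne_zero ?_
    rw [ShiftOperator.mulRightMatrix_mul, Matrix.det_mul, Polynomial.C_1, one_mul]
  · obtain ⟨U, V, hUV⟩ := ShiftOperator.exists_bezout hL₁ hgcd
    obtain ⟨B, hB⟩ := hlcm.1
    obtain ⟨A, rfl⟩ := hlcm.2.1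
    obtain ⟨c, hc, hdet⟩ := ShiftOperator.exists_det_mulRightMatrix_eq p hL₁ hL₂ hB hlcm hUV
    have hA : A ≠ 0 := by
      rintro rfl
      have : NeZero p := ⟨(Fact.out : p.Prime).ne_zero⟩
      have h := ((ShiftOperator.hasPrimitiveLead_det_mulRightMatrix p hL₁).C_mul hc).ne_zero
      rw [← hdet] at h
      exact h ((congrArg Matrix.det (map_zero (ShiftOperator.mulRightHom p))).trans Matrix.det_zero)
    refine ShiftOperator.shiftEquivalent_of_hasPrimitiveLead p (mul_ne_zero hA hL₂) hL₁ hL₂ hc ?_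
    rw [ShiftOperator.mulRightMatrix_mul, Matrix.det_mul, hdet, mul_assoc]
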